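/- Work over the modal language $\mathcal{L}=\{\wedge,\vee,\to,\top,\bot,\Box,\Diamond\}$ with countably many atoms. A \emph{logic} is a set of formulas closed under substitution, modus ponens and necessitation; $\mathsf{CK}$ is the least logic containing intuitionistic propositional logic, $\Box(p\to q)\to(\Box p\to\Box q)$ and $\Box(p\to q)\to(\Diamond p\to\Diamond q)$. A logic $L\supseteq\mathsf{CK}$ is \emph{$T$-free} if all its formulas are valid in the one-node irreflexive Kripke frame, and \emph{$T$-full} if it contains $\Box p\to p$ and $p\to\Diamond p$ and all its formulas are valid in the one-node reflexive Kripke frame (the node not being fallible). \emph{Basic} formulas are built from atoms, $\top$, $\bot$ by $\wedge,\vee,\Diamond$. \emph{Almost positive} formulas form the least set containing the basic formulas and closed under $\wedge,\vee,\Box,\Diamond$ and under $A\to B$ with $A$ basic and $B$ almost positive. \emph{Constructive} formulas form the least set containing the basic formulas and closed under $\wedge,\Box$ and under $A\to B$ with $A$ almost positive and $B$ constructive. All sequents are single-conclusion: $\Sigma\Rightarrow\Lambda$ with $\Sigma,\Lambda$ finite multisets of formulas and $\Lambda$ having at most one element. A \emph{left constructive} rule has the form $$\frac{\{\Gamma,\overline{B_i}\Rightarrow\overline{P_i}\}_{i\in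 I}\qquad\{\Gamma,\overline{C_j}\Rightarrow\Delta\}_{j\in J}}{\Gamma,\overline{P}\Rightarrow\Delta}$$ and a \emph{right constructive} rule has the form $$\frac{\{\Gamma,\overline{B_i}\Rightarrow\overline{P_i}\}_{i\in I}}{\Gamma,\overline{P}\Rightarrow\overline{C}}$$ where $I,J$ are finite and possibly empty, $\Gamma,\Delta$ are multiset variables, the $\overline{B_i}$ are multisets of basic formulas, $\overline{P},\overline{P_i}$ of almost positive formulas, $\overline{C},\overline{C_j}$ of constructive formulas, $\overline{P_i},\overline{C},\Delta$ have at most one element, and if $|J|>1$ all formulas in the $\overline{C_j}$ are basic. An instance of a rule is obtained by substituting formulas for the atoms and multisets of formulas for the multiset variables. A \emph{constructive sequent calculus} is a finite set of rules, each of which is left or right constructive, or is the rule $(K_\Box)$: from $\Gamma\Rightarrow p$ infer $\Box\Gamma\Rightarrow\Box p$, or the rule $(K_\Diamond)$: from $\Gamma,p\Rightarrow q$ infer $\Box\Gamma,\Diamond p\Rightarrow\Diamond q$. It is a calculus \emph{for} $L$ if, for every sequent $\Sigma\Rightarrow\Lambda$, it proves $\Sigma\Rightarrow\Lambda$ if and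 only if $\bigwedge\Sigma\to\bigvee\Lambda\in L$ (where $\bigwedge\varnothing=\top$ and $\bigvee\varnothing=\bot$). For $n\ge1$, \emph{Visser's rule} $V_n$ is $$\frac{\Rightarrow\left(\bigwedge_{i=1}^n(p_i\to q_i)\to p_{n+1}\vee p_{n+2}\right)\vee r}{\Rightarrow\bigvee_{j=1}^{n+2}\left(\bigwedge_{i=1}^n(p_i\to q_i)\to p_j\right)\vee r}$$ and it is admissible in $L$ if for each of its instances, $\bigwedge\Sigma\to\bigvee\Lambda\in L$ for the premise $\Sigma\Rightarrow\Lambda$ implies the same for the conclusion. $V_0$ is said to be admissible in $L$ if $L$ has the disjunction property: $A\vee B\in L$ implies $A\in L$ or $B\in L$. \textbf{Corollary.} Let $L$ be a $T$-free or a $T$-full logic over $\mathcal{L}$. If for some $n\ge0$ Visser's rule $V_n$ is not admissible in $L$, then there is no constructive sequent calculus for $L$. -/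

import Mathlib

namespace IML

/-! ### Formulas -/

/-- Modal formulas over `{∧, ∨, →, ⊤, ⊥, □, ◇}`, with countably many atoms. -/
inductive Formula : Type
  | atom : ℕ → Formula
  | top : Formula
  | bot : Formula
  | and : Formula → Formula → Formula
  | or : Formula → Formula → Formula
  | imp : Formula → Formula → Formula
  | box : Formula → Formula
  | dia : Formula → Formula

namespace Formula

/-- Simultaneous substitution of formulas for atoms. -/
def subst (σ : ℕ → Formula) : Formula → Formula
  | atom p => σ p
  | top => top
  | bot => bot
  | and A B => and (subst σ A) (subst σ B)
  | or A B => or (subst σ A) (subst σ B)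
  | imp A B => imp (subst σ A) (subst σ B)
  | box A => box (subst σ A)
  | dia A => dia (subst σ A)

/-- `⋀ [A₁, …, Aₙ] = A₁ ∧ (A₂ ∧ (… ∧ Aₙ))`, with `⋀ [] = ⊤`. -/
def conj : List Formula → Formula
  | [] => top
  | [A] => A
  | A :: B :: l => and A (conj (B :: l))

/-- `⋁ [A₁, …, Aₙ] = A₁ ∨ (A₂ ∨ (… ∨ Aₙ))`, with `⋁ [] = ⊥`. -/
def disj : List Formula → Formula
  | [] => bot
  | [A] => A
  | A :: B :: l => or A (disj (B :: l))

end Formula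

open Formula

/-! ### Logics -/

/-- A logic: a set of formulas closed under substitution, modus ponens and necessitation. -/
structure IsLogic (L : Set Formula) : Prop where
  subst_mem : ∀ (σ : ℕ → Formula) (A : Formula), A ∈ L → A.subst σ ∈ L
  mp : ∀ A B : Formula, A ∈ L → imp A B ∈ L → B ∈ L
  nec : ∀ A : Formula, A ∈ L → box A ∈ L

/-- The smallest logic containing a set of formulas. -/
def leastLogic (X : Set Formula) : Set Formula :=
  {A | ∀ L : Set Formula, IsLogic L → X ⊆ L → A ∈ L}

/-- A Hilbert-style axiomatization of intuitionistic propositional logic. -/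
inductive IPCAxiom : Formula → Prop
  | k : IPCAxiom (imp (atom 0) (imp (atom 1) (atom 0)))
  | s : IPCAxiom (imp (imp (atom 0) (imp (atom 1) (atom 2)))
      (imp (imp (atom 0) (atom 1)) (imp (atom 0) (atom 2))))
  | and_left : IPCAxiom (imp (and (atom 0) (atom 1)) (atom 0))
  | and_right : IPCAxiom (imp (and (atom 0) (atom 1)) (atom 1))
  | and_intro : IPCAxiom (imp (atom 0) (imp (atom 1) (and (atom 0) (atom 1))))
  | or_left : IPCAxiom (imp (atom 0) (or (atom 0) (atom 1)))
  | or_right : IPCAxiom (imp (atom 1) (or (atom 0) (atom 1)))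
  | or_elim : IPCAxiom (imp (imp (atom 0) (atom 2))
      (imp (imp (atom 1) (atom 2)) (imp (or (atom 0) (atom 1)) (atom 2))))
  | bot_elim : IPCAxiom (imp bot (atom 0))
  | top_intro : IPCAxiom top

/-- `□(p → q) → (□p → □q)`. -/
def axKa : Formula :=
  imp (box (imp (atom 0) (atom 1))) (imp (box (atom 0)) (box (atom 1)))

/-- `□(p → q) → (◇p → ◇q)`. -/
def axKb : Formula :=
  imp (box (imp (atom 0) (atom 1))) (imp (dia (atom 0)) (dia (atom 1)))

/-- `□p → p`. -/
def axTa : Formula := imp (box (atom 0)) (atom 0)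

/-- `p → ◇p`. -/
def axTb : Formula := imp (atom 0) (dia (atom 0))

/-- The logic `CK = IPC + {K_a, K_b}`. -/
def CK : Set Formula := leastLogic ({A | IPCAxiom A} ∪ {axKa, axKb})

/-! ### Constructive modal Kripke frames -/

/-- A constructive modal Kripke frame `(W, ≤, R, F)`, with `F` the set of fallible worlds. -/
structure Frame where
  W : Type
  nonempty : Nonempty W
  le : W → W → Prop
  le_refl : ∀ w, le w w
  le_trans : ∀ u v w, le u v → le v w → le u w
  R : W → W → Prop
  F : Set W
  F_le : ∀ v w, v ∈ F → le v w → w ∈ F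
  F_R : ∀ v w, R v w → v ∈ F → w ∈ F
  F_serial : ∀ v, v ∈ F → ∃ w, w ∈ F ∧ R v w

/-- A valuation on a frame: monotone, and making every atom true at the fallible worlds. -/
structure Frame.IsValuation (𝓕 : Frame) (V : 𝓕.W → Set ℕ) : Prop where
  mono : ∀ v w, 𝓕.le v w → V v ⊆ V w
  fallible : ∀ w, w ∈ 𝓕.F → ∀ p, p ∈ V w

/-- Truth of a formula at a world. -/
def Frame.Forces (𝓕 : Frame) (V : 𝓕.W → Set ℕ) : 𝓕.W → Formula → Prop
  | w, .atom p => p ∈ V w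
  | _, .top => True
  | w, .bot => w ∈ 𝓕.F
  | w, .and A B => 𝓕.Forces V w A ∧ 𝓕.Forces V w B
  | w, .or A B => 𝓕.Forces V w A ∨ 𝓕.Forces V w B
  | w, .imp A B => ∀ v, 𝓕.le w v → 𝓕.Forces V v A → 𝓕.Forces V v B
  | w, .box A => ∀ u, 𝓕.le w u → ∀ v, 𝓕.R u v → 𝓕.Forces V v A
  | w, .dia A => ∀ u, 𝓕.le w u → ∃ v, 𝓕.R u v ∧ 𝓕.Forces V v A

/-- A formula is valid in a frame if it is true at all worlds of all models on the frame. -/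
def Frame.Valid (𝓕 : Frame) (A : Formula) : Prop :=
  ∀ V : 𝓕.W → Set ℕ, 𝓕.IsValuation V → ∀ w, 𝓕.Forces V w A

/-- A logic is valid in a frame if all its members are. -/
def Frame.ValidLogic (𝓕 : Frame) (L : Set Formula) : Prop := ∀ A ∈ L, 𝓕.Valid A

/-- The irreflexive node frame `({w}, =, ∅, ∅)`. -/
def irreflexiveNode : Frame where
  W := Unit
  nonempty := ⟨()⟩
  le := fun v w => v = w
  le_refl := fun _ => rfl
  le_trans := fun _ _ _ h₁ h₂ => h₁.trans h₂
  R := fun _ _ => False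
  F := ∅
  F_le := fun _ _ h _ => h.elim
  F_R := fun _ _ _ h => h.elim
  F_serial := fun _ h => h.elim

/-- The reflexive node frame `({w}, =, {(w, w)}, ∅)`. -/
def reflexiveNode : Frame where
  W := Unit
  nonempty := ⟨()⟩
  le := fun v w => v = w
  le_refl := fun _ => rfl
  le_trans := fun _ _ _ h₁ h₂ => h₁.trans h₂
  R := fun _ _ => True
  F := ∅
  F_le := fun _ _ h _ => h.elim
  F_R := fun _ _ _ h => h.elim
  F_serial := fun _ h => h.elim

/-- `T`-free: extends `CK` and is valid in the irreflexive node frame. -/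
structure TFree (L : Set Formula) : Prop where
  ck : CK ⊆ L
  valid : irreflexiveNode.ValidLogic L

/-- `T`-full: extends `CK`, contains `T_a` and `T_b`, and is valid in the reflexive node frame. -/
structure TFull (L : Set Formula) : Prop where
  ck : CK ⊆ L
  ta : axTa ∈ L
  tb : axTb ∈ L
  valid : reflexiveNode.ValidLogic L

/-! ### Sequents, rules and calculi -/

/-- A single-conclusion sequent: a finite multiset of formulas as antecedent, at most one formula
as succedent. -/
structure Sequent where
  ant : Multiset Formula
  suc : Option Formula

/-- The formula interpretation `⋀ Σ → ⋁ Λ` of the sequent `Σ ⇒ Λ` belongs to `L`, in whatever order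
the antecedent is enumerated. -/
def Sequent.InterpMem (S : Sequent) (L : Set Formula) : Prop :=
  ∀ l : List Formula, (l : Multiset Formula) = S.ant → imp (conj l) (disj S.suc.toList) ∈ L

/-- The succedent of a single-conclusion meta-sequent: a multiset variable (which may be
instantiated by at most one formula) or at most one formula. -/
inductive MetaSuc : Type
  | var : ℕ → MetaSuc
  | formula : Option Formula → MetaSuc

/-- A single-conclusion meta-sequent `{□Γᵢ}, {Πⱼ}, Ā ⇒ Δ` or `{□Γᵢ}, {Πⱼ}, Ā ⇒ B̄`; the multiset
variables `Γᵢ`, `Πⱼ` are given by their numbers. -/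
structure MetaSequent where
  boxed : Multiset ℕ
  ctx : Multiset ℕ
  formulas : Multiset Formula
  suc : MetaSuc

/-- An instantiation: formulas for the atoms, finite multisets of formulas for the multiset
variables in antecedents, at most one formula for those in succedents. -/
structure Inst where
  atoms : ℕ → Formula
  left : ℕ → Multiset Formula
  right : ℕ → Option Formula

/-- The instance of the succedent of a meta-sequent. -/
def MetaSuc.inst (ι : Inst) : MetaSuc → Option Formula
  | var Δ => ι.right Δ
  | formula B => B.map (Formula.subst ι.atoms)

/-- The instance of a meta-sequent. -/
def MetaSequent.inst (ι : Inst) (M : MetaSequent) : Sequent where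
  ant := (M.boxed.map fun Γ => (ι.left Γ).map box).sum + (M.ctx.map ι.left).sum
    + M.formulas.map (Formula.subst ι.atoms)
  suc := M.suc.inst ι

/-- A rule; an axiom is a rule without premises. -/
structure Rule where
  premises : Multiset MetaSequent
  conclusion : MetaSequent

/-- Provability of a sequent from a set of rules. -/
inductive Provable (G : Set Rule) : Sequent → Prop
  | step (R : Rule) (hR : R ∈ G) (ι : Inst)
      (h : ∀ M ∈ R.premises, Provable G (M.inst ι)) : Provable G (R.conclusion.inst ι)

/-- `G` is a sequent calculus of the logic `L`: `Σ ⇒ Λ` is provable in `G` iff `⋀ Σ → ⋁ Λ ∈ L`. -/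
def IsCalculusOf (G : Set Rule) (L : Set Formula) : Prop :=
  ∀ S : Sequent, Provable G S ↔ S.InterpMem L

/-- Admissibility of a rule in a logic. -/
def Rule.Admissible (R : Rule) (L : Set Formula) : Prop :=
  ∀ ι : Inst, (∀ M ∈ R.premises, (M.inst ι).InterpMem L) → (R.conclusion.inst ι).InterpMem L

/-! ### Constructive formulas and rules -/

/-- Basic formulas. -/
inductive Basic : Formula → Prop
  | atom (p : ℕ) : Basic (atom p)
  | top : Basic top
  | bot : Basic bot
  | and {A B : Formula} : Basic A → Basic B → Basic (and A B)
  | or {A B : Formula} : Basic A → Basic B → Basic (or A B)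
  | dia {A : Formula} : Basic A → Basic (dia A)

/-- Almost positive formulas. -/
inductive AlmostPositive : Formula → Prop
  | basic {A : Formula} : Basic A → AlmostPositive A
  | and {A B : Formula} : AlmostPositive A → AlmostPositive B → AlmostPositive (and A B)
  | or {A B : Formula} : AlmostPositive A → AlmostPositive B → AlmostPositive (or A B)
  | box {A : Formula} : AlmostPositive A → AlmostPositive (box A)
  | dia {A : Formula} : AlmostPositive A → AlmostPositive (dia A)
  | imp {A B : Formula} : Basic A → AlmostPositive B → AlmostPositive (imp A B)

/-- Constructive formulas. -/
inductive Constructive : Formula → Prop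
  | basic {A : Formula} : Basic A → Constructive A
  | and {A B : Formula} : Constructive A → Constructive B → Constructive (and A B)
  | box {A : Formula} : Constructive A → Constructive (box A)
  | imp {A B : Formula} : AlmostPositive A → Constructive B → Constructive (imp A B)

/-- The meta-sequent `Γ, Ā ⇒ B̄`. -/
def ctxFormula (Γ : ℕ) (A : Multiset Formula) (B : Option Formula) : MetaSequent :=
  ⟨0, {Γ}, A, .formula B⟩

/-- The meta-sequent `Γ, Ā ⇒ Δ`. -/
def ctxVar (Γ : ℕ) (A : Multiset Formula) (Δ : ℕ) : MetaSequent :=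
  ⟨0, {Γ}, A, .var Δ⟩

/-- Left constructive rules: from `{Γ, B̄ᵢ ⇒ P̄ᵢ}` (`i ∈ I`) and `{Γ, C̄ⱼ ⇒ Δ}` (`j ∈ J`) infer
`Γ, P̄ ⇒ Δ`. The families are the multisets `I` of pairs `(B̄ᵢ, P̄ᵢ)` and `J` of the `C̄ⱼ`. -/
def Rule.LeftConstructive (R : Rule) : Prop :=
  ∃ (Γ Δ : ℕ) (I : Multiset (Multiset Formula × Option Formula))
    (J : Multiset (Multiset Formula)) (P : Multiset Formula),
    (∀ i ∈ I, (∀ A ∈ i.1, Basic A) ∧ (∀ A ∈ i.2, AlmostPositive A)) ∧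
    (∀ C ∈ J, ∀ A ∈ C, Constructive A) ∧
    (1 < Multiset.card J → ∀ C ∈ J, ∀ A ∈ C, Basic A) ∧
    (∀ A ∈ P, AlmostPositive A) ∧
    R.premises = (I.map fun i => ctxFormula Γ i.1 i.2) + (J.map fun C => ctxVar Γ C Δ) ∧
    R.conclusion = ctxVar Γ P Δ

/-- Right constructive rules: from `{Γ, B̄ᵢ ⇒ P̄ᵢ}` (`i ∈ I`) infer `Γ, P̄ ⇒ C̄`. -/
def Rule.RightConstructive (R : Rule) : Prop :=
  ∃ (Γ : ℕ) (I : Multiset (Multiset Formula × Option Formula))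
    (P : Multiset Formula) (C : Option Formula),
    (∀ i ∈ I, (∀ A ∈ i.1, Basic A) ∧ (∀ A ∈ i.2, AlmostPositive A)) ∧
    (∀ A ∈ P, AlmostPositive A) ∧
    (∀ A ∈ C, Constructive A) ∧
    R.premises = (I.map fun i => ctxFormula Γ i.1 i.2) ∧
    R.conclusion = ctxFormula Γ P C

/-- The rule `(K_□)`: from `Γ ⇒ p` infer `□Γ ⇒ □p`. -/
def Rule.IsKBox (R : Rule) : Prop :=
  ∃ Γ p : ℕ, R.premises = {ctxFormula Γ 0 (some (atom p))} ∧
    R.conclusion = ⟨{Γ}, 0, 0, .formula (some (box (atom p)))⟩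

/-- The rule `(K_◇)`: from `Γ, p ⇒ q` infer `□Γ, ◇p ⇒ ◇q`. -/
def Rule.IsKDia (R : Rule) : Prop :=
  ∃ Γ p q : ℕ, p ≠ q ∧ R.premises = {ctxFormula Γ {atom p} (some (atom q))} ∧
    R.conclusion = ⟨{Γ}, 0, {dia (atom p)}, .formula (some (dia (atom q)))⟩

/-- A constructive sequent calculus: a finite set of rules, each of which is left or right
constructive, or `(K_□)`, or `(K_◇)`. -/
structure IsConstructiveCalculus (G : Set Rule) : Prop where
  finite : G.Finite
  rules : ∀ R ∈ G, R.LeftConstructive ∨ R.RightConstructive ∨ R.IsKBox ∨ R.IsKDia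

/-! ### Visser's rules -/

/-- The atom `pⱼ` in Visser's rules, `j ≥ 1`. The atoms `pⱼ`, `qᵢ` and `r = atom 0` are pairwise
distinct. -/
def visserP (j : ℕ) : Formula := atom (2 * j)

/-- The atom `qᵢ` in Visser's rules, `i ≥ 1`. -/
def visserQ (i : ℕ) : Formula := atom (2 * i + 1)

/-- `⋀_{i=1}^{n} (pᵢ → qᵢ)`. -/
def visserAnt (n : ℕ) : Formula :=
  conj ((List.range n).map fun i => imp (visserP (i + 1)) (visserQ (i + 1)))

/-- The rule `V_n`: from `⇒ (⋀_{i=1}^{n} (pᵢ → qᵢ) → p_{n+1} ∨ p_{n+2}) ∨ r` infer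
`⇒ ⋁_{j=1}^{n+2} (⋀_{i=1}^{n} (pᵢ → qᵢ) → pⱼ) ∨ r`. -/
def visserRule (n : ℕ) : Rule where
  premises := {⟨0, 0, 0, .formula (some
    (or (imp (visserAnt n) (or (visserP (n + 1)) (visserP (n + 2)))) (atom 0)))⟩}
  conclusion := ⟨0, 0, 0, .formula (some
    (or (disj ((List.range (n + 2)).map fun j => imp (visserAnt n) (visserP (j + 1)))) (atom 0)))⟩

/-- The disjunction property. -/
def DisjunctionProperty (L : Set Formula) : Prop :=
  ∀ A B : Formula, or A B ∈ L → A ∈ L ∨ B ∈ L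

/-- `L` admits `V_n`; admitting `V_0` means having the disjunction property. -/
def AdmitsVisser (L : Set Formula) : ℕ → Prop
  | 0 => DisjunctionProperty L
  | n + 1 => (visserRule (n + 1)).Admissible L

end IML


/-!
Fix a theory `T ⊇ L`. The Kleene–Aczel slash `T ∣ A`, with the modalities read as at a single
node, singles out members of `T` by a condition that mimics truth at that node: for basic `A` the
slash of `A.subst σ` *is* the truth of `A` under the valuation `{p | T ∣ σ p}`. It follows that a
constructive formula valid at the node has all its instances in `T` slashed, and so every instance
of a constructive formula of `L` is slashed.

A sound constructive rule amounts to a constructive formula of `L`: instantiate its context by the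
formulas `⋀ B̄ᵢ → ⋁ P̄ᵢ`, and `Δ` by `⋁ⱼ ⋀ C̄ⱼ`. Hence constructive rules preserve the slash, as do
`(K_□)` and `(K_◇)`, and if `L` has a constructive calculus, then all of `L` is slashed in each
theory `T ⊇ L`. For `T = L` this yields the disjunction property. For the theory
`T = L + ⋀ᵢ (Pᵢ → Qᵢ)`, if no `Pᵢ` is in `T`, then each `Pᵢ → Qᵢ` is slashed because `Pᵢ` is not,
whence `A ∨ B ∈ T` implies `A ∈ T` or `B ∈ T`; this is Visser's rule.
-/

namespace IML

open Formula

/-! ### Conjunctions, disjunctions and substitutions -/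

namespace Formula

theorem conj_induction {p : Formula → Prop} (top : p top)
    (and : ∀ A B, p A → p B → p (and A B)) :
    ∀ {l : List Formula}, (∀ A ∈ l, p A) → p (conj l)
  | [], _ => top
  | [A], h => h A (List.mem_singleton_self A)
  | A :: B :: l, h =>
    and A (conj (B :: l)) (h A List.mem_cons_self)
      (conj_induction top and fun C hC => h C (List.mem_cons_of_mem A hC))

theorem disj_induction {p : Formula → Prop} (bot : p bot)
    (or : ∀ A B, p A → p B → p (or A B)) :
    ∀ {l : List Formula}, (∀ A ∈ l, p A) → p (disj l)
  | [], _ => bot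
  | [A], h => h A (List.mem_singleton_self A)
  | A :: B :: l, h =>
    or A (disj (B :: l)) (h A List.mem_cons_self)
      (disj_induction bot or fun C hC => h C (List.mem_cons_of_mem A hC))

theorem conj_iff_forall {p : Formula → Prop} (top : p top)
    (and : ∀ A B, p (and A B) ↔ p A ∧ p B) (l : List Formula) :
    p (conj l) ↔ ∀ A ∈ l, p A := by
  induction l with
  | nil => simpa [conj] using top
  | cons A l ih => cases l <;> simp_all [conj]

theorem subst_atom : subst atom = id := by
  funext A
  induction A <;> simp_all [subst]

theorem subst_conj (σ : ℕ → Formula) (l : List Formula) :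
    (conj l).subst σ = conj (l.map (subst σ)) := by
  induction l with
  | nil => rfl
  | cons A l ih => cases l <;> simp_all [conj, subst]

theorem subst_disj (σ : ℕ → Formula) (l : List Formula) :
    (disj l).subst σ = disj (l.map (subst σ)) := by
  induction l with
  | nil => rfl
  | cons A l ih => cases l <;> simp_all [disj, subst]

/-- The substitution `p₀ ↦ A`, `p₁ ↦ B`, `pₙ ↦ C` for `n ≥ 2`, used to instantiate axioms. -/
def threeAtoms (A B C : Formula) : ℕ → Formula
  | 0 => A
  | 1 => B
  | _ => C

end Formula

theorem Basic.conj {l : List Formula} (h : ∀ A ∈ l, Basic A) : Basic (conj l) :=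
  conj_induction .top (fun _ _ => .and) h

theorem Basic.disj {l : List Formula} (h : ∀ A ∈ l, Basic A) : Basic (disj l) :=
  disj_induction .bot (fun _ _ => .or) h

theorem Constructive.conj {l : List Formula} (h : ∀ A ∈ l, Constructive A) :
    Constructive (conj l) :=
  conj_induction (.basic .top) (fun _ _ => .and) h

theorem AlmostPositive.conj {l : List Formula} (h : ∀ A ∈ l, AlmostPositive A) :
    AlmostPositive (conj l) :=
  conj_induction (.basic .top) (fun _ _ => .and) h

/-! ### Intuitionistic theories -/

/-- A theory over intuitionistic propositional logic: a set of formulas containing all instances of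
the axioms and closed under modus ponens, but not necessarily under substitution or
necessitation. -/
structure IsTheory (T : Set Formula) : Prop where
  ipc_mem : ∀ A, IPCAxiom A → ∀ σ, A.subst σ ∈ T
  mp : ∀ A B, A ∈ T → imp A B ∈ T → B ∈ T

/-- The theory generated by `T` and the formula `H`, given by the deduction theorem. -/
def adjoin (T : Set Formula) (H : Formula) : Set Formula := {A | imp H A ∈ T}

namespace IsTheory

variable {T : Set Formula} (hT : IsTheory T) {A B H : Formula}
include hT

theorem top_mem : top ∈ T := hT.ipc_mem _ .top_intro atom

theorem imp_mem_of_mem (hA : A ∈ T) : imp H A ∈ T :=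
  hT.mp _ _ hA (hT.ipc_mem _ .k (threeAtoms A H H))

theorem subset_adjoin : T ⊆ adjoin T H := fun _ => hT.imp_mem_of_mem

theorem adjoin : IsTheory (adjoin T H) where
  ipc_mem A hA σ := hT.subset_adjoin (hT.ipc_mem A hA σ)
  mp A B hA hAB := hT.mp _ _ hA (hT.mp _ _ hAB (hT.ipc_mem _ .s (threeAtoms H A B)))

theorem mem_adjoin_self : H ∈ IML.adjoin T H :=
  hT.adjoin.mp (imp H H) H (hT.ipc_mem _ .k (threeAtoms H H H))
    (hT.ipc_mem _ .k (threeAtoms H (imp H H) H))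

theorem and_mem_iff : and A B ∈ T ↔ A ∈ T ∧ B ∈ T :=
  ⟨fun h => ⟨hT.mp _ _ h (hT.ipc_mem _ .and_left (threeAtoms A B B)),
    hT.mp _ _ h (hT.ipc_mem _ .and_right (threeAtoms A B B))⟩,
  fun h => hT.mp _ _ h.2 (hT.mp _ _ h.1 (hT.ipc_mem _ .and_intro (threeAtoms A B B)))⟩

theorem or_mem_left (h : A ∈ T) : or A B ∈ T :=
  hT.mp _ _ h (hT.ipc_mem _ .or_left (threeAtoms A B B))

theorem or_mem_right (h : B ∈ T) : or A B ∈ T :=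
  hT.mp _ _ h (hT.ipc_mem _ .or_right (threeAtoms A B B))

theorem conj_mem_iff (l : List Formula) : conj l ∈ T ↔ ∀ A ∈ l, A ∈ T :=
  conj_iff_forall (p := (· ∈ T)) hT.top_mem (fun _ _ => hT.and_mem_iff) l

theorem disj_mem_of_mem {l : List Formula} (hA : A ∈ l) (h : A ∈ T) : disj l ∈ T := by
  induction l with
  | nil => simp at hA
  | cons B l ih =>
    rcases l with _ | ⟨C, l⟩
    · obtain rfl := List.mem_singleton.1 hA
      exact h
    · rcases List.mem_cons.1 hA with rfl | hA
      · exact hT.or_mem_left h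
      · exact hT.or_mem_right (ih hA)

theorem imp_conj_mem_iff (l : List Formula) :
    imp (conj l) B ∈ T ↔ ∀ U : Set Formula, IsTheory U → T ⊆ U → (∀ A ∈ l, A ∈ U) → B ∈ U :=
  ⟨fun h _ hU hTU hl => hU.mp _ _ ((hU.conj_mem_iff l).2 hl) (hTU h),
    fun h => h _ hT.adjoin hT.subset_adjoin ((hT.adjoin.conj_mem_iff l).1 hT.mem_adjoin_self)⟩

theorem interpMem_iff (S : Sequent) : S.InterpMem T ↔
    ∀ U, IsTheory U → T ⊆ U → (∀ A ∈ S.ant, A ∈ U) → disj S.suc.toList ∈ U := by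
  simp only [Sequent.InterpMem, hT.imp_conj_mem_iff]
  refine ⟨fun h => by simpa using h S.ant.toList S.ant.coe_toList, fun h l hl => ?_⟩
  simpa [← hl] using h

theorem interpMem_zero_some_iff : Sequent.InterpMem ⟨0, some A⟩ T ↔ A ∈ T := by
  rw [hT.interpMem_iff]
  exact ⟨fun h => h T hT subset_rfl (by simp), fun h U _ hTU _ => hTU h⟩

end IsTheory

namespace Sequent

/-- The result `Σσ ⇒ Λσ` of a substitution in the sequent `Σ ⇒ Λ`. -/
def subst (σ : ℕ → Formula) (S : Sequent) : Sequent :=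
  ⟨S.ant.map (Formula.subst σ), S.suc.map (Formula.subst σ)⟩

/-- The formula interpretation `⋀ Σ → ⋁ Λ` of the sequent `Σ ⇒ Λ`, for one enumeration of `Σ`. -/
noncomputable def interp (S : Sequent) : Formula :=
  imp (conj S.ant.toList) (disj S.suc.toList)

theorem subst_atom (S : Sequent) : S.subst atom = S := by
  rcases S with ⟨_, _ | A⟩ <;> simp [subst, Formula.subst_atom]

theorem interp_subst_mem_iff {T : Set Formula} (hT : IsTheory T) (S : Sequent)
    (σ : ℕ → Formula) : S.interp.subst σ ∈ T ↔ (S.subst σ).InterpMem T := by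
  simp only [interp, Formula.subst, subst_conj, subst_disj, hT.imp_conj_mem_iff, hT.interpMem_iff]
  simp [subst, Option.toList_map]

theorem interp_mem_iff {T : Set Formula} (hT : IsTheory T) (S : Sequent) :
    S.interp ∈ T ↔ S.InterpMem T := by
  simpa only [Formula.subst_atom, id_eq, subst_atom] using S.interp_subst_mem_iff hT atom

theorem interpMem_add_of_interp_mem {T : Set Formula} (hT : IsTheory T) {Γ : Multiset Formula}
    {S : Sequent} (hS : S.interp ∈ Γ) : InterpMem ⟨Γ + S.ant, S.suc⟩ T := by
  refine (hT.interpMem_iff _).2 fun U hU _ hant => ?_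
  have hSU : S.InterpMem U := (S.interp_mem_iff hU).1 (hant _ (Multiset.mem_add.2 (.inl hS)))
  exact (hU.interpMem_iff S).1 hSU U hU subset_rfl fun A hA =>
    hant A (Multiset.mem_add.2 (.inr hA))

theorem InterpMem.of_add {L T : Set Formula} (hL : IsTheory L) (hT : IsTheory T) (hLT : L ⊆ T)
    {Γ : Multiset Formula} (hΓ : ∀ A ∈ Γ, A ∈ T) {S : Sequent}
    (hS : InterpMem ⟨Γ + S.ant, S.suc⟩ L) : S.InterpMem T := by
  refine (hT.interpMem_iff S).2 fun U hU hTU hant => ?_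
  refine (hL.interpMem_iff _).1 hS U hU (hLT.trans hTU) fun A hA => ?_
  exact (Multiset.mem_add.1 hA).elim (fun hA => hTU (hΓ A hA)) (hant A)

theorem almostPositive_interp {S : Sequent} (hant : ∀ A ∈ S.ant, Basic A)
    (hsuc : ∀ A ∈ S.suc, AlmostPositive A) : AlmostPositive S.interp := by
  refine .imp (.conj fun A hA => hant A (Multiset.mem_toList.1 hA)) ?_
  rcases S with ⟨_, _ | A⟩
  · exact .basic .bot
  · exact hsuc A rfl

theorem constructive_interp {S : Sequent} (hant : ∀ A ∈ S.ant, AlmostPositive A)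
    (hsuc : ∀ A ∈ S.suc, Constructive A) : Constructive S.interp := by
  refine .imp (.conj fun A hA => hant A (Multiset.mem_toList.1 hA)) ?_
  rcases S with ⟨_, _ | A⟩
  · exact .basic .bot
  · exact hsuc A rfl

end Sequent

/-! ### Logics of a node -/

/-- The one-node frame without fallible worlds whose node is reflexive iff `t`. -/
def node (t : Prop) : Frame where
  W := Unit
  nonempty := ⟨()⟩
  le := fun v w => v = w
  le_refl := fun _ => rfl
  le_trans := fun _ _ _ h₁ h₂ => h₁.trans h₂
  R := fun _ _ => t
  F := ∅
  F_le := fun _ _ h _ => h.elim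
  F_R := fun _ _ _ h => h.elim
  F_serial := fun _ h => h.elim

/-- Truth at the node of `node t` under the valuation `V`. -/
def NodeTruth (t : Prop) (V : Set ℕ) : Formula → Prop
  | .atom p => p ∈ V
  | .top => True
  | .bot => False
  | .and A B => NodeTruth t V A ∧ NodeTruth t V B
  | .or A B => NodeTruth t V A ∨ NodeTruth t V B
  | .imp A B => NodeTruth t V A → NodeTruth t V B
  | .box A => t → NodeTruth t V A
  | .dia A => t ∧ NodeTruth t V A

theorem forces_node_iff {t : Prop} (V : Unit → Set ℕ) (w : Unit) (A : Formula) :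
    (node t).Forces V w A ↔ NodeTruth t (V ()) A := by
  induction A with
  | bot => exact Set.mem_empty_iff_false _
  | _ => simp_all [Frame.Forces, NodeTruth, node]

/-- The common form of `T`-free logics (`t = False`) and `T`-full logics (`t = True`). -/
structure IsNodeLogic (t : Prop) (L : Set Formula) : Prop extends IsLogic L where
  ck : CK ⊆ L
  ta : t → axTa ∈ L
  tb : t → axTb ∈ L
  valid : (node t).ValidLogic L

theorem TFree.isNodeLogic {L : Set Formula} (h : TFree L) (hL : IsLogic L) :
    IsNodeLogic False L :=
  { hL with ck := h.ck, ta := False.elim, tb := False.elim, valid := h.valid }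

theorem TFull.isNodeLogic {L : Set Formula} (h : TFull L) (hL : IsLogic L) :
    IsNodeLogic True L :=
  { hL with ck := h.ck, ta := fun _ => h.ta, tb := fun _ => h.tb, valid := h.valid }

namespace IsLogic

variable {L : Set Formula} (hL : IsLogic L) (hCK : CK ⊆ L)
include hL hCK

theorem isTheory : IsTheory L where
  ipc_mem A hA σ := hL.subst_mem σ A (hCK fun _ _ hX => hX (Or.inl hA))
  mp := hL.mp

theorem isTheory_setOf_box_mem {T : Set Formula} (hT : IsTheory T) (hLT : L ⊆ T) :
    IsTheory {A | box A ∈ T} where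
  ipc_mem A hA σ := hLT (hL.nec _ ((hL.isTheory hCK).ipc_mem A hA σ))
  mp A B hA hAB := hT.mp _ _ hA <| hT.mp _ _ hAB <| hLT <|
    hL.subst_mem (threeAtoms A B B) _ (hCK fun _ _ hX => hX (Or.inr (Or.inl rfl)))

end IsLogic

namespace IsNodeLogic

variable {t : Prop} {L : Set Formula} (hL : IsNodeLogic t L)
include hL

theorem isTheory : IsTheory L := hL.toIsLogic.isTheory hL.ck

theorem imp_box_self_mem (ht : t) (A : Formula) : imp (box A) A ∈ L :=
  hL.subst_mem (threeAtoms A A A) _ (hL.ta ht)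

theorem imp_self_dia_mem (ht : t) (A : Formula) : imp A (dia A) ∈ L :=
  hL.subst_mem (threeAtoms A A A) _ (hL.tb ht)

theorem nodeTruth_of_mem {A : Formula} (hA : A ∈ L) (V : Set ℕ) : NodeTruth t V A :=
  (forces_node_iff (fun _ => V) () A).1 <|
    hL.valid A hA (fun _ => V) ⟨fun _ _ _ => subset_rfl, fun _ h => h.elim⟩ ()

end IsNodeLogic

/-! ### The slash -/

/-- The Kleene–Aczel slash `T ∣ A`, extended to the modalities by reading them as at the node of
`node t`. -/
def Slash (t : Prop) (T : Set Formula) : Formula → Prop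
  | .atom p => .atom p ∈ T
  | .top => True
  | .bot => False
  | .and A B => Slash t T A ∧ Slash t T B
  | .or A B => Slash t T A ∨ Slash t T B
  | .imp A B => .imp A B ∈ T ∧ (Slash t T A → Slash t T B)
  | .box A => .box A ∈ T ∧ (t → Slash t T A)
  | .dia A => t ∧ Slash t T A

/-- The valuation under which an atom is true iff its substitute is slashed. -/
def slashVal (t : Prop) (T : Set Formula) (σ : ℕ → Formula) : Set ℕ := {p | Slash t T (σ p)}

/-- A sequent is slashed in `T` if its succedent contains a slashed formula whenever all formulas of
its antecedent are slashed. -/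
def Sequent.Slashed (t : Prop) (T : Set Formula) (S : Sequent) : Prop :=
  (∀ A ∈ S.ant, Slash t T A) → ∃ A ∈ S.suc, Slash t T A

/-- A set of formulas is slashable if its members are slashed in every theory containing it. -/
def Slashable (t : Prop) (L : Set Formula) : Prop :=
  ∀ T, IsTheory T → L ⊆ T → ∀ A ∈ L, Slash t T A

section Slash

variable {t : Prop} {T : Set Formula} {σ : ℕ → Formula} {A : Formula}

theorem slash_conj_iff (l : List Formula) : Slash t T (conj l) ↔ ∀ A ∈ l, Slash t T A :=
  conj_iff_forall trivial (fun _ _ => Iff.rfl) l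

theorem slash_disj_iff (l : List Formula) : Slash t T (disj l) ↔ ∃ A ∈ l, Slash t T A := by
  induction l with
  | nil => simp [disj, Slash]
  | cons A l ih => cases l <;> simp_all [disj, Slash]

theorem Basic.slash_subst_iff (hA : Basic A) :
    Slash t T (A.subst σ) ↔ NodeTruth t (slashVal t T σ) A := by
  induction hA <;> simp_all [subst, Slash, NodeTruth, slashVal]

theorem AlmostPositive.nodeTruth_of_slash (hA : AlmostPositive A) (h : Slash t T (A.subst σ)) :
    NodeTruth t (slashVal t T σ) A := by
  induction hA with
  | basic hA => exact hA.slash_subst_iff.1 h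
  | and _ _ ihA ihB => exact ⟨ihA h.1, ihB h.2⟩
  | or _ _ ihA ihB => exact h.imp ihA ihB
  | box _ ih => exact fun ht => ih (h.2 ht)
  | dia _ ih => exact ⟨h.1, ih h.2⟩
  | imp hA _ ih => exact fun hV => ih (h.2 (hA.slash_subst_iff.2 hV))

theorem mem_of_slash (hT : IsTheory T) (htb : t → ∀ A, imp A (dia A) ∈ T) (h : Slash t T A) :
    A ∈ T := by
  induction A with
  | atom p => exact h
  | top => exact hT.top_mem
  | bot => exact h.elim
  | and A B ihA ihB => exact hT.and_mem_iff.2 ⟨ihA h.1, ihB h.2⟩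
  | or A B ihA ihB => exact h.elim (hT.or_mem_left <| ihA ·) (hT.or_mem_right <| ihB ·)
  | imp A B => exact h.1
  | box A => exact h.1
  | dia A ih => exact hT.mp _ _ (ih h.2) (htb h.1 A)

theorem Constructive.slash_subst_of_nodeTruth (hT : IsTheory T)
    (hta : t → ∀ A, Formula.imp (Formula.box A) A ∈ T)
    (htb : t → ∀ A, Formula.imp A (Formula.dia A) ∈ T) (hA : Constructive A)
    (hmem : A.subst σ ∈ T) (hV : NodeTruth t (slashVal t T σ) A) : Slash t T (A.subst σ) := by
  induction hA with
  | basic hA => exact hA.slash_subst_iff.2 hV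
  | and _ _ ihA ihB =>
    obtain ⟨hmemA, hmemB⟩ := hT.and_mem_iff.1 hmem
    exact ⟨ihA hmemA hV.1, ihB hmemB hV.2⟩
  | box _ ih => exact ⟨hmem, fun ht => ih (hT.mp _ _ hmem (hta ht _)) (hV ht)⟩
  | imp hA _ ih =>
    exact ⟨hmem, fun hS =>
      ih (hT.mp _ _ (mem_of_slash hT htb hS) hmem) (hV (hA.nodeTruth_of_slash hS))⟩

theorem Sequent.slash_interp_subst_iff (hT : IsTheory T) (S : Sequent) :
    Slash t T (S.interp.subst σ) ↔ (S.subst σ).InterpMem T ∧ (S.subst σ).Slashed t T := by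
  rw [← S.interp_subst_mem_iff hT]
  refine and_congr Iff.rfl ?_
  rw [subst_conj, subst_disj, slash_conj_iff, slash_disj_iff]
  simp [Slashed, subst]

end Slash

namespace IsNodeLogic

variable {t : Prop} {L T : Set Formula} (hL : IsNodeLogic t L) (hT : IsTheory T) (hLT : L ⊆ T)
  {A : Formula}
include hL hT hLT

theorem mem_of_slash (h : Slash t T A) : A ∈ T :=
  IML.mem_of_slash hT (fun ht A => hLT (hL.imp_self_dia_mem ht A)) h

theorem slash_subst_of_constructive (hA : Constructive A) (hmem : A ∈ L) (σ : ℕ → Formula) :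
    Slash t T (A.subst σ) :=
  hA.slash_subst_of_nodeTruth hT (fun ht A => hLT (hL.imp_box_self_mem ht A))
    (fun ht A => hLT (hL.imp_self_dia_mem ht A)) (hLT (hL.subst_mem σ A hmem))
    (hL.nodeTruth_of_mem hmem _)

end IsNodeLogic

/-! ### Constructive rules as constructive formulas -/

theorem inst_ctxFormula (ι : Inst) (Γ : ℕ) (A : Multiset Formula) (B : Option Formula) :
    (ctxFormula Γ A B).inst ι =
      ⟨ι.left Γ + A.map (Formula.subst ι.atoms), B.map (Formula.subst ι.atoms)⟩ := by
  simp [ctxFormula, MetaSequent.inst, MetaSuc.inst]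

theorem inst_ctxVar (ι : Inst) (Γ : ℕ) (A : Multiset Formula) (Δ : ℕ) :
    (ctxVar Γ A Δ).inst ι = ⟨ι.left Γ + A.map (Formula.subst ι.atoms), ι.right Δ⟩ := by
  simp [ctxVar, MetaSequent.inst, MetaSuc.inst]

theorem IsCalculusOf.admissible {G : Set Rule} {L : Set Formula} (hG : IsCalculusOf G L)
    {R : Rule} (hR : R ∈ G) : R.Admissible L :=
  fun ι h => (hG _).1 (.step R hR ι fun M hM => (hG _).2 (h M hM))

/-- The formulas `⋀ B̄ᵢ → ⋁ P̄ᵢ` for `(B̄ᵢ, P̄ᵢ)` in `I`: the weakest context that makes the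
premises `Γ, B̄ᵢ ⇒ P̄ᵢ` of a constructive rule derivable. -/
noncomputable def premiseContext (I : Multiset (Multiset Formula × Option Formula)) :
    Multiset Formula :=
  I.map fun i => (Sequent.mk i.1 i.2).interp

/-- The formula `⋁ⱼ ⋀ C̄ⱼ` for `C̄ⱼ` in `J`: the strongest value of `Δ` that makes the premises
`Γ, C̄ⱼ ⇒ Δ` of a left constructive rule derivable. -/
noncomputable def disjConj (J : Multiset (Multiset Formula)) : Formula :=
  disj (J.map fun C => conj C.toList).toList

theorem constructive_disjConj {J : Multiset (Multiset Formula)}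
    (hJ : ∀ C ∈ J, ∀ A ∈ C, Constructive A)
    (hbasic : 1 < Multiset.card J → ∀ C ∈ J, ∀ A ∈ C, Basic A) : Constructive (disjConj J) := by
  by_cases hcard : 1 < Multiset.card J
  · refine .basic (.disj fun A hA => ?_)
    obtain ⟨C, hC, rfl⟩ := Multiset.mem_map.1 (Multiset.mem_toList.1 hA)
    exact .conj fun A hA => hbasic hcard C hC A (Multiset.mem_toList.1 hA)
  · obtain hcard | hcard := Nat.le_one_iff_eq_zero_or_eq_one.1 (not_lt.1 hcard)
    · obtain rfl := Multiset.card_eq_zero.1 hcard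
      simpa [disjConj, disj] using Constructive.basic .bot
    · obtain ⟨C, rfl⟩ := Multiset.card_eq_one.1 hcard
      simpa [disjConj, disj] using Constructive.conj (l := C.toList) (by simpa using hJ)

theorem slash_disjConj_subst_iff {t : Prop} {T : Set Formula} {σ : ℕ → Formula}
    (J : Multiset (Multiset Formula)) :
    Slash t T ((disjConj J).subst σ) ↔ ∃ C ∈ J, ∀ A ∈ C, Slash t T (A.subst σ) := by
  simp [disjConj, subst_disj, slash_disj_iff, subst_conj, slash_conj_iff]

theorem IsTheory.disjConj_mem {T : Set Formula} (hT : IsTheory T)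
    {J : Multiset (Multiset Formula)} {C : Multiset Formula} (hC : C ∈ J)
    (hmem : ∀ A ∈ C, A ∈ T) : disjConj J ∈ T :=
  hT.disj_mem_of_mem (Multiset.mem_toList.2 (Multiset.mem_map_of_mem _ hC))
    ((hT.conj_mem_iff _).2 fun A hA => hmem A (Multiset.mem_toList.1 hA))

section RuleFormula

variable {L : Set Formula} (hL : IsTheory L) {R : Rule} (hR : R.Admissible L) {Γ Δ : ℕ}
  {I : Multiset (Multiset Formula × Option Formula)} {P : Multiset Formula}
include hL hR

theorem interpMem_of_admissible_right {C : Option Formula}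
    (hprem : R.premises = I.map fun i => ctxFormula Γ i.1 i.2)
    (hconc : R.conclusion = ctxFormula Γ P C) :
    Sequent.InterpMem ⟨premiseContext I + P, C⟩ L := by
  let ι : Inst := ⟨atom, fun _ => premiseContext I, fun _ => none⟩
  have hinst (A B) : (ctxFormula Γ A B).inst ι = ⟨premiseContext I + A, B⟩ := by
    simp [inst_ctxFormula, subst_atom, ι]
  rw [← hinst, ← hconc]
  refine hR ι fun M hM => ?_
  rw [hprem] at hM
  obtain ⟨i, hi, rfl⟩ := Multiset.mem_map.1 hM
  rw [hinst]
  exact Sequent.interpMem_add_of_interp_mem hL (S := ⟨i.1, i.2⟩) (Multiset.mem_map_of_mem _ hi)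

theorem interpMem_of_admissible_left {J : Multiset (Multiset Formula)}
    (hprem : R.premises = (I.map fun i => ctxFormula Γ i.1 i.2) + J.map fun C => ctxVar Γ C Δ)
    (hconc : R.conclusion = ctxVar Γ P Δ) :
    Sequent.InterpMem ⟨premiseContext I + P, some (disjConj J)⟩ L := by
  let ι : Inst := ⟨atom, fun _ => premiseContext I, fun _ => some (disjConj J)⟩
  have hformula (A B) : (ctxFormula Γ A B).inst ι = ⟨premiseContext I + A, B⟩ := by
    simp [inst_ctxFormula, subst_atom, ι]
  have hvar (A) : (ctxVar Γ A Δ).inst ι = ⟨premiseContext I + A, some (disjConj J)⟩ := by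
    simp [inst_ctxVar, subst_atom, ι]
  rw [← hvar, ← hconc]
  refine hR ι fun M hM => ?_
  rw [hprem, Multiset.mem_add, Multiset.mem_map, Multiset.mem_map] at hM
  obtain ⟨i, hi, rfl⟩ | ⟨C, hC, rfl⟩ := hM
  · rw [hformula]
    exact Sequent.interpMem_add_of_interp_mem hL (S := ⟨i.1, i.2⟩) (Multiset.mem_map_of_mem _ hi)
  · rw [hvar]
    refine (hL.interpMem_iff _).2 fun T hT _ hant => ?_
    exact hT.disjConj_mem hC fun A hA => hant A (Multiset.mem_add.2 (.inr hA))

end RuleFormula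

/-! ### Slashability from a constructive calculus -/

namespace IsNodeLogic

variable {t : Prop} {L T : Set Formula} (hL : IsNodeLogic t L) (hT : IsTheory T) (hLT : L ⊆ T)
include hL hT hLT

theorem slash_interp_subst_of_premise {ι : Inst} {Γ : ℕ} {B : Multiset Formula}
    {P : Option Formula} (hmem : ((ctxFormula Γ B P).inst ι).InterpMem L)
    (hsl : ((ctxFormula Γ B P).inst ι).Slashed t T) (hΓ : ∀ A ∈ ι.left Γ, Slash t T A) :
    Slash t T ((Sequent.mk B P).interp.subst ι.atoms) := by
  rw [inst_ctxFormula] at hmem hsl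
  refine (Sequent.slash_interp_subst_iff hT _).2 ⟨?_, fun hant => hsl fun A hA => ?_⟩
  · exact Sequent.InterpMem.of_add hL.isTheory hT hLT
      (fun A hA => hL.mem_of_slash hT hLT (hΓ A hA)) hmem
  · exact (Multiset.mem_add.1 hA).elim (hΓ A) (hant A)

theorem exists_slash_subst_of_interpMem
    {I : Multiset (Multiset Formula × Option Formula)} {P : Multiset Formula} {C : Option Formula}
    (hI : ∀ i ∈ I, (∀ A ∈ i.1, Basic A) ∧ (∀ A ∈ i.2, AlmostPositive A))
    (hP : ∀ A ∈ P, AlmostPositive A) (hC : ∀ A ∈ C, Constructive A)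
    (hmem : Sequent.InterpMem ⟨premiseContext I + P, C⟩ L) {σ : ℕ → Formula}
    (hIσ : ∀ i ∈ I, Slash t T ((Sequent.mk i.1 i.2).interp.subst σ))
    (hPσ : ∀ A ∈ P, Slash t T (A.subst σ)) : ∃ A ∈ C, Slash t T (A.subst σ) := by
  have hcons : Constructive (Sequent.mk (premiseContext I + P) C).interp := by
    refine Sequent.constructive_interp (fun A hA => ?_) hC
    rcases Multiset.mem_add.1 hA with hA | hA
    · obtain ⟨i, hi, rfl⟩ := Multiset.mem_map.1 hA
      exact Sequent.almostPositive_interp (hI i hi).1 (hI i hi).2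
    · exact hP A hA
  have hslash := hL.slash_subst_of_constructive hT hLT hcons
    ((Sequent.interp_mem_iff hL.isTheory _).2 hmem) σ
  obtain ⟨_, hAσ, hS⟩ := ((Sequent.slash_interp_subst_iff hT _).1 hslash).2 fun A hA => by
    obtain ⟨B, hB, rfl⟩ := Multiset.mem_map.1 hA
    rcases Multiset.mem_add.1 hB with hB | hB
    · obtain ⟨i, hi, rfl⟩ := Multiset.mem_map.1 hB
      exact hIσ i hi
    · exact hPσ B hB
  obtain ⟨A, hA, rfl⟩ := Option.map_eq_some_iff.1 hAσ
  exact ⟨A, hA, hS⟩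

section Rules

variable {R : Rule} {ι : Inst} (hmem : ∀ M ∈ R.premises, (M.inst ι).InterpMem L)
  (hsl : ∀ M ∈ R.premises, (M.inst ι).Slashed t T)
include hmem hsl

theorem slashed_inst_of_rightConstructive (hR : R.RightConstructive) (hadm : R.Admissible L) :
    (R.conclusion.inst ι).Slashed t T := by
  obtain ⟨Γ, I, P, C, hI, hP, hC, hprem, hconc⟩ := hR
  rw [hconc, inst_ctxFormula]
  intro hant
  simp only [Multiset.mem_add, Multiset.mem_map] at hant
  have hIσ : ∀ i ∈ I, Slash t T ((Sequent.mk i.1 i.2).interp.subst ι.atoms) := fun i hi => by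
    have hi' : ctxFormula Γ i.1 i.2 ∈ R.premises := by
      rw [hprem]
      exact Multiset.mem_map_of_mem _ hi
    exact hL.slash_interp_subst_of_premise hT hLT (hmem _ hi') (hsl _ hi')
      fun A hA => hant A (.inl hA)
  obtain ⟨A, hA, hS⟩ := hL.exists_slash_subst_of_interpMem hT hLT hI hP hC
    (interpMem_of_admissible_right hL.isTheory hadm hprem hconc) hIσ
    fun A hA => hant _ (.inr ⟨A, hA, rfl⟩)
  exact ⟨_, Option.mem_map_of_mem _ hA, hS⟩

theorem slashed_inst_of_leftConstructive (hR : R.LeftConstructive) (hadm : R.Admissible L) :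
    (R.conclusion.inst ι).Slashed t T := by
  obtain ⟨Γ, Δ, I, J, P, hI, hJ, hJbasic, hP, hprem, hconc⟩ := hR
  rw [hconc, inst_ctxVar]
  intro hant
  simp only [Multiset.mem_add, Multiset.mem_map] at hant
  have hIσ : ∀ i ∈ I, Slash t T ((Sequent.mk i.1 i.2).interp.subst ι.atoms) := fun i hi => by
    have hi' : ctxFormula Γ i.1 i.2 ∈ R.premises := by
      rw [hprem]
      exact Multiset.mem_add.2 (.inl (Multiset.mem_map_of_mem _ hi))
    exact hL.slash_interp_subst_of_premise hT hLT (hmem _ hi') (hsl _ hi')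
      fun A hA => hant A (.inl hA)
  obtain ⟨_, hA, hS⟩ := hL.exists_slash_subst_of_interpMem hT hLT (C := some (disjConj J)) hI hP
    (fun _ hA => Option.mem_some_iff.1 hA ▸ constructive_disjConj hJ hJbasic)
    (interpMem_of_admissible_left hL.isTheory hadm hprem hconc) hIσ
    fun A hA => hant _ (.inr ⟨A, hA, rfl⟩)
  obtain rfl := Option.mem_some_iff.1 hA
  obtain ⟨C, hC, hCσ⟩ := (slash_disjConj_subst_iff J).1 hS
  have hC' : ctxVar Γ C Δ ∈ R.premises := by
    rw [hprem]
    exact Multiset.mem_add.2 (.inr (Multiset.mem_map_of_mem (ctxVar Γ · Δ) hC))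
  have hslC := hsl _ hC'
  rw [inst_ctxVar] at hslC
  refine hslC fun A hA => ?_
  simp only [Multiset.mem_add, Multiset.mem_map] at hA
  rcases hA with hA | ⟨B, hB, rfl⟩
  · exact hant A (.inl hA)
  · exact hCσ B hB

theorem slashed_inst_of_isKBox (hR : R.IsKBox) : (R.conclusion.inst ι).Slashed t T := by
  obtain ⟨Γ, p, hprem, hconc⟩ := hR
  simp only [hprem, Multiset.mem_singleton, forall_eq, inst_ctxFormula, Multiset.map_zero,
    add_zero] at hmem hsl
  rw [hconc]
  intro hant
  have hΓ : ∀ A ∈ ι.left Γ, Slash t T (box A) := fun A hA => hant _ (by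
    simpa [MetaSequent.inst] using hA)
  refine ⟨box (ι.atoms p), rfl, ?_, fun ht => ?_⟩
  · exact (hL.isTheory.interpMem_iff _).1 hmem _
      (hL.isTheory_setOf_box_mem hL.ck hT hLT) (fun A hA => hLT (hL.nec A hA))
      fun A hA => (hΓ A hA).1
  · obtain ⟨_, hA, hp⟩ := hsl fun A hA => (hΓ A hA).2 ht
    obtain rfl := Option.mem_some_iff.1 hA
    exact hp

end Rules

end IsNodeLogic

theorem slashed_inst_of_isKDia {t : Prop} {T : Set Formula} {R : Rule} {ι : Inst}
    (hsl : ∀ M ∈ R.premises, (M.inst ι).Slashed t T) (hR : R.IsKDia) :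
    (R.conclusion.inst ι).Slashed t T := by
  obtain ⟨Γ, p, q, -, hprem, hconc⟩ := hR
  simp only [hprem, Multiset.mem_singleton, forall_eq, inst_ctxFormula] at hsl
  rw [hconc]
  intro hant
  have hΓ : ∀ A ∈ ι.left Γ, Slash t T (box A) := fun A hA => hant _ (by
    simp [MetaSequent.inst, hA])
  have hp : Slash t T (dia (ι.atoms p)) := hant _ (by simp [MetaSequent.inst, subst])
  obtain ⟨_, hB, hq⟩ := hsl fun A hA => by
    rcases Multiset.mem_add.1 hA with hA | hA
    · exact (hΓ A hA).2 hp.1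
    · obtain rfl := Multiset.mem_singleton.1 hA
      exact hp.2
  obtain rfl := Option.mem_some_iff.1 hB
  exact ⟨dia (ι.atoms q), rfl, hp.1, hq⟩

namespace IsNodeLogic

variable {t : Prop} {L : Set Formula} (hL : IsNodeLogic t L)
include hL

theorem slashable {G : Set Rule}
    (hG : ∀ R ∈ G, R.LeftConstructive ∨ R.RightConstructive ∨ R.IsKBox ∨ R.IsKDia)
    (hGL : IsCalculusOf G L) : Slashable t L := by
  intro T hT hLT A hA
  have slashed_of_provable {S : Sequent} (hS : Provable G S) : S.Slashed t T := by
    induction hS with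
    | step R hR ι h hsl =>
      have hmem : ∀ M ∈ R.premises, (M.inst ι).InterpMem L := fun M hM => (hGL _).1 (h M hM)
      rcases hG R hR with hleft | hright | hbox | hdia
      · exact hL.slashed_inst_of_leftConstructive hT hLT hmem hsl hleft (hGL.admissible hR)
      · exact hL.slashed_inst_of_rightConstructive hT hLT hmem hsl hright (hGL.admissible hR)
      · exact hL.slashed_inst_of_isKBox hT hLT hmem hsl hbox
      · exact slashed_inst_of_isKDia hsl hdia
  have hprov : Provable G ⟨0, some A⟩ := (hGL _).2 (hL.isTheory.interpMem_zero_some_iff.2 hA)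
  obtain ⟨_, hAS, hS⟩ := slashed_of_provable hprov (by simp)
  obtain rfl := Option.mem_some_iff.1 hAS
  exact hS

/-! ### Visser's rules in slashable logics -/

theorem disjunctionProperty (hS : Slashable t L) : DisjunctionProperty L :=
  fun _ _ hAB => (hS L hL.isTheory subset_rfl _ hAB).imp
    (hL.mem_of_slash hL.isTheory subset_rfl) (hL.mem_of_slash hL.isTheory subset_rfl)

theorem exists_imp_mem_of_imp_or_mem (hS : Slashable t L) {α : Type*} {P Q : α → Formula}
    {s : List α} {A B H : Formula} (hH : H = conj (s.map fun i => imp (P i) (Q i)))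
    (hAB : imp H (or A B) ∈ L) : (∃ i ∈ s, imp H (P i) ∈ L) ∨ imp H A ∈ L ∨ imp H B ∈ L := by
  have hT : IsTheory (adjoin L H) := hL.isTheory.adjoin
  have hLT : L ⊆ adjoin L H := hL.isTheory.subset_adjoin
  refine or_iff_not_imp_left.2 fun hP => ?_
  have himp : ∀ X ∈ s.map fun i => imp (P i) (Q i), X ∈ adjoin L H := by
    rw [← hT.conj_mem_iff, ← hH]
    exact hL.isTheory.mem_adjoin_self
  have hslash : Slash t (adjoin L H) (conj (s.map fun i => imp (P i) (Q i))) := by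
    refine (slash_conj_iff _).2 fun X hX => ?_
    obtain ⟨i, hi, rfl⟩ := List.mem_map.1 hX
    exact ⟨himp _ hX, fun hPi => absurd ⟨i, hi, hL.mem_of_slash hT hLT hPi⟩ hP⟩
  rw [← hH] at hslash
  exact ((hS _ hT hLT _ hAB).2 hslash).imp (hL.mem_of_slash hT hLT) (hL.mem_of_slash hT hLT)

theorem exists_imp_visserAnt_mem (hS : Slashable t L) (n : ℕ) (σ : ℕ → Formula)
    (h : (imp (visserAnt n) (or (visserP (n + 1)) (visserP (n + 2)))).subst σ ∈ L) :
    ∃ j < n + 2, (imp (visserAnt n) (visserP (j + 1))).subst σ ∈ L := by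
  have hant : (visserAnt n).subst σ = conj ((List.range n).map fun i =>
      imp ((visserP (i + 1)).subst σ) ((visserQ (i + 1)).subst σ)) := by
    rw [visserAnt, subst_conj, List.map_map]
    rfl
  obtain ⟨i, hi, hiL⟩ | hL' | hL' := hL.exists_imp_mem_of_imp_or_mem hS hant h
  · exact ⟨i, (List.mem_range.1 hi).trans (by lia), hiL⟩
  · exact ⟨n, by lia, hL'⟩
  · exact ⟨n + 1, by lia, hL'⟩

theorem visserRule_admissible (hS : Slashable t L) (n : ℕ) : (visserRule n).Admissible L := by
  intro ι h
  have hprem := hL.isTheory.interpMem_zero_some_iff.1 (h _ (Multiset.mem_singleton_self _))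
  refine hL.isTheory.interpMem_zero_some_iff.2 ?_
  rcases hL.disjunctionProperty hS _ _ hprem with himp | hr
  · obtain ⟨j, hj, hjL⟩ := hL.exists_imp_visserAnt_mem hS n ι.atoms himp
    refine hL.isTheory.or_mem_left ?_
    rw [subst_disj, List.map_map]
    exact hL.isTheory.disj_mem_of_mem (List.mem_map.2 ⟨j, List.mem_range.2 hj, rfl⟩) hjL
  · exact hL.isTheory.or_mem_right hr

theorem admitsVisser (hS : Slashable t L) : ∀ n, AdmitsVisser L n
  | 0 => hL.disjunctionProperty hS
  | n + 1 => hL.visserRule_admissible hS (n + 1)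

end IsNodeLogic

end IML

theorem mainTheorem4_general (L : Set IML.Formula) (hL : IML.IsLogic L)
    (hT : IML.TFree L ∨ IML.TFull L) {G : Set IML.Rule}
    (hG : ∀ R ∈ G, R.LeftConstructive ∨ R.RightConstructive ∨ R.IsKBox ∨ R.IsKDia)
    (hGL : IML.IsCalculusOf G L) (n : ℕ) : IML.AdmitsVisser L n := by
  obtain ⟨t, hN⟩ : ∃ t, IML.IsNodeLogic t L :=
    hT.elim (fun h => ⟨_, h.isNodeLogic hL⟩) (fun h => ⟨_, h.isNodeLogic hL⟩)
  exact hN.admitsVisser (hN.slashable hG hGL) n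

theorem mainTheorem4 (L : Set IML.Formula) (hL : IML.IsLogic L)
    (hT : IML.TFree L ∨ IML.TFull L)
    (hV : ∃ n : ℕ, ¬ IML.AdmitsVisser L n) :
    ¬ ∃ G : Set IML.Rule, IML.IsConstructiveCalculus G ∧ IML.IsCalculusOf G L :=
  fun ⟨_, hG, hGL⟩ => hV.elim fun n hn => hn (mainTheorem4_general L hL hT hG.rules hGL n)
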